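/- **Theorem 1.2 (strong-diameter network decomposition).** In the $\mathsf{LOCAL}$ model, the nodes of a network $G=(V,E)$ (a finite simple undirected graph) carry distinct identifiers and compute in synchronous rounds; in every round each node sends one message of unbounded size to each of its neighbors, receives the messages of its neighbors, and performs arbitrary local computation. At the start a node knows its own identifier, the identifiers of its neighbors, an upper bound $N$ on $n=|V|$, and an upper bound $b$ on the number of bits of the identifiers. The running time is the number of rounds until every node has irrevocably decided on its output. There is a deterministic algorithm in the $\mathsf{LOCAL}$ model such that for every constant $c$ there is a constant $C$ with the following property. Let $G$ be any graph with $n\ge 2$ nodes, let $n\le N\le n^{c}$ and $b\le c\log n$, and let the nodes have distinct $b$-bit identifiers. Then within at most $C\log^{8} n$ rounds every node outputs a color, and these outputs partition $V$ into $k\le C\log n$ color classes $V_1,\dots,V_k$ such that, for each $i$, every connected component of the induced subgraph $G[V_i]$ has diameter at most $C\log n$, where the diameter is measured within that component. -/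

import Mathlib

namespace LocalModel

universe u

/-- A deterministic algorithm of the LOCAL model, run by every node of a network.
`Param` is the global information handed to all nodes at the start, `Out` the type of local
outputs. States and messages may be of any type (messages are of unbounded size and local
computation is free), and the algorithm is fixed before the network is. -/
structure LocalAlgorithm (Param Out : Type) where
  /-- The local states of a node. -/
  State : Type
  /-- The messages. -/
  Msg : Type
  /-- Initial state of a node, from the global information, its own identifier and the
  identifiers of its neighbors. -/
  init : Param → ℕ → Finset ℕ → State
  /-- `send s j`: the message that a node in state `s` sends to its neighbor with
  identifier `j`. -/
  send : State → ℕ → Msg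
  /-- `receive s M`: the new state of a node in state `s` that received the messages `M`,
  each tagged with the identifier of its sender. -/
  receive : State → Finset (ℕ × Msg) → State
  /-- The output of a node in the given state; `none` as long as it has not decided. -/
  output : State → Option Out

namespace LocalAlgorithm

variable {Param Out : Type} {V : Type u} [Fintype V]

open Classical in
/-- The state of node `v` after `t` synchronous rounds on the network `G` with identifiers `ident`:
in every round each node sends one message to each neighbor, and then updates its state from the
messages that its neighbors sent to it in this round. -/
noncomputable def stateAt (A : LocalAlgorithm Param Out) (G : SimpleGraph V) (ident : V → ℕ)
    (p : Param) : ℕ → V → A.State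
  | 0, v => A.init p (ident v) ((G.neighborFinset v).image ident)
  | t + 1, v =>
      A.receive (A.stateAt G ident p t v)
        ((G.neighborFinset v).image fun w =>
          (ident w, A.send (A.stateAt G ident p t w) (ident v)))

/-- On the network `G` with identifiers `ident` and global information `p`, every node `v` decides
within `T` rounds, irrevocably, on the output `out v`. -/
def OutputsWithin (A : LocalAlgorithm Param Out) (G : SimpleGraph V) (ident : V → ℕ)
    (p : Param) (T : ℕ) (out : V → Out) : Prop :=
  ∀ v, ∃ t ≤ T,
    (∀ s < t, A.output (A.stateAt G ident p s v) = none) ∧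
    (∀ s, t ≤ s → A.output (A.stateAt G ident p s v) = some (out v))

end LocalAlgorithm

/-- `col` is a network decomposition of `G` with `k` colors `0, …, k - 1` and strong diameter at
most `d`: each connected component of the subgraph induced by the vertices of one color,
as a graph of its own, has diameter at most `d`. -/
def IsStrongNetworkDecomposition {V : Type u} (G : SimpleGraph V) (col : V → ℕ)
    (k d : ℕ) : Prop :=
  (∀ v, col v < k) ∧
  ∀ i < k, ∀ K : (G.induce {v | col v = i}).ConnectedComponent,
    K.toSimpleGraph.ediam ≤ (d : ℕ∞)

/-- The global information known to all nodes: an upper bound on the number of nodes of the network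
and the length of the identifiers. -/
structure GlobalInfo where
  /-- an upper bound on the number of nodes -/
  sizeBound : ℕ
  /-- an upper bound on the number of bits of the identifiers -/
  idBits : ℕ

end LocalModel

/-! Colors are produced one at a time. Each takes at least a quarter of the vertices still
uncolored, so `3 * b` colors exhaust at most `2 ^ b` vertices.

For one color, singleton clusters are merged bit by bit. In phase `i`, a vertex whose label has bit
`i` set asks to join an adjacent cluster whose bit is unset; the cluster accepts if it grows
noticeably, otherwise the askers are dropped. Growth bounds the length of a phase
(`proposal_phaseLength`), a charging argument shows that half the vertices survive all phases
(`live_clustering_le`), and in the end adjacent survivors share all label bits (`agree_clustering`).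
Distinct clusters are then nonadjacent, but a cluster is only known to have small diameter in the
whole of `G`. As local computation is free, its members learn its topology and grow balls inside it
sequentially (`exists_carving`), keeping half of it with radius `b` inside the kept set.

Rounds are counted by `IsLocal`: for fixed `b` the construction is a function of graphs on `Fin (2 ^
b)`, read off from views by a decoder that does not depend on the graph. A network embeds there
through its identifiers, the unused ones becoming isolated vertices. -/

namespace LocalModel

/-! ### Balls measured inside a vertex set -/

section Balls

variable {V : Type*} {G H : SimpleGraph V} {U W : Set V} {r s : ℕ} {u v w : V}

/-- The vertices that a walk of length at most `r` inside `U` connects to `v`. -/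
def ball (G : SimpleGraph V) (U : Set V) : ℕ → V → Set V
  | 0, v => {w | w = v ∧ v ∈ U}
  | r + 1, v => {w | v ∈ U ∧ (w ∈ ball G U r v ∨ ∃ x, G.Adj v x ∧ w ∈ ball G U r x)}

theorem ball_subset : ball G U r v ⊆ U := by
  induction r generalizing v with
  | zero => rintro w ⟨rfl, h⟩; exact h
  | succ r ih =>
    rintro w ⟨-, h | ⟨x, -, h⟩⟩
    exacts [ih h, ih h]

theorem left_mem_of_mem_ball (h : w ∈ ball G U r v) : v ∈ U := by
  cases r with
  | zero => exact h.2
  | succ r => exact h.1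

theorem self_mem_ball (h : v ∈ U) : v ∈ ball G U r v := by
  induction r with
  | zero => exact ⟨rfl, h⟩
  | succ r ih => exact ⟨h, Or.inl ih⟩

theorem ball_subset_succ : ball G U r v ⊆ ball G U (r + 1) v := fun _ h =>
  ⟨left_mem_of_mem_ball h, Or.inl h⟩

theorem ball_mono_radius (h : r ≤ s) : ball G U r v ⊆ ball G U s v := by
  induction h with
  | refl => exact subset_rfl
  | step _ ih => exact ih.trans ball_subset_succ

theorem ball_mono (hG : G ≤ H) (hU : U ⊆ W) : ball G U r v ⊆ ball H W r v := by
  induction r generalizing v with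
  | zero => rintro w ⟨rfl, h⟩; exact ⟨rfl, hU h⟩
  | succ r ih =>
    rintro w ⟨h0, h | ⟨x, hx, h⟩⟩
    exacts [⟨hU h0, Or.inl (ih h)⟩, ⟨hU h0, Or.inr ⟨x, hG hx, ih h⟩⟩]

theorem mem_ball_trans (h : w ∈ ball G U r v) (h' : u ∈ ball G U s w) :
    u ∈ ball G U (r + s) v := by
  induction r generalizing v with
  | zero => obtain ⟨rfl, -⟩ := h; simpa using h'
  | succ r ih =>
    rw [Nat.succ_add]
    obtain ⟨h0, h | ⟨x, hx, h⟩⟩ := h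
    exacts [⟨h0, Or.inl (ih h)⟩, ⟨h0, Or.inr ⟨x, hx, ih h⟩⟩]

theorem mem_ball_one (h : G.Adj v w) (hv : v ∈ U) (hw : w ∈ U) : w ∈ ball G U 1 v :=
  ⟨hv, Or.inr ⟨w, h, rfl, hw⟩⟩

theorem mem_ball_symm (h : w ∈ ball G U r v) : v ∈ ball G U r w := by
  induction r generalizing v with
  | zero => obtain ⟨rfl, h⟩ := h; exact ⟨rfl, h⟩
  | succ r ih =>
    obtain ⟨h0, h | ⟨x, hx, h⟩⟩ := h
    · exact ball_subset_succ (ih h)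
    · exact mem_ball_trans (ih h) (mem_ball_one hx.symm (left_mem_of_mem_ball h) h0)

theorem mem_ball_succ_of_adj (h : u ∈ ball G U r v) (hw : w ∈ U) (huw : G.Adj u w) :
    w ∈ ball G U (r + 1) v :=
  mem_ball_trans h (mem_ball_one huw (ball_subset h) hw)

/-- A walk of length at most `r` from `v` never leaves the ball. This turns balls into sets of small
strong radius. -/
theorem ball_subset_ball_ball : ball G U r v ⊆ ball G (ball G U r v) r v := by
  suffices ∀ k ≤ r, ∀ w ∈ ball G U k v, w ∈ ball G (ball G U r v) k v from
    fun w hw => this r le_rfl w hw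
  intro k
  induction k with
  | zero => rintro hk w ⟨rfl, h⟩; exact ⟨rfl, self_mem_ball h⟩
  | succ k ih =>
    intro hk w hw
    -- The recursion peels off the first edge; reversing the walk exposes the last one instead.
    have hw' := mem_ball_symm hw
    have hwr : w ∈ ball G U r v := ball_mono_radius hk hw
    obtain ⟨h0, h | ⟨x, hx, h⟩⟩ := hw'
    · exact ball_subset_succ (ih (by omega) w (mem_ball_symm h))
    · exact mem_ball_succ_of_adj (ih (by omega) x (mem_ball_symm h)) hwr hx.symm

end Balls

/-! ### Sequential ball growing -/

section Carving

variable {V : Type*} {G H : SimpleGraph V} {U W X : Set V} {b : ℕ}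

/-- `cent` certifies that the components of `G[W]` have radius at most `r`. -/
structure IsCentering (G : SimpleGraph V) (W : Set V) (r : ℕ) (cent : V → V) : Prop where
  mem_ball : ∀ w ∈ W, w ∈ ball G W r (cent w)
  eq_of_adj : ∀ v ∈ W, ∀ w ∈ W, G.Adj v w → cent v = cent w

/-- Otherwise the ball would double `b + 1` times and outgrow `V`. -/
theorem exists_ball_succ_le [Finite V] (hV : Nat.card V ≤ 2 ^ b) {x : V} (hx : x ∈ U) :
    ∃ r ≤ b, (ball G U (r + 1) x).ncard ≤ 2 * (ball G U r x).ncard := by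
  by_contra! h
  have key : ∀ r ≤ b + 1, 2 ^ r ≤ (ball G U r x).ncard := by
    intro r
    induction r with
    | zero =>
      intro _
      exact (Set.ncard_pos).2 ⟨x, self_mem_ball hx⟩
    | succ r ih =>
      intro hr
      have := ih (by omega)
      have := h r (by omega)
      rw [pow_succ]
      omega
  have h1 := key (b + 1) le_rfl
  have h2 : (ball G U (b + 1) x).ncard ≤ Nat.card V := Set.ncard_le_card _
  have h3 : 2 ^ b < 2 ^ (b + 1) := Nat.pow_lt_pow_right (by norm_num) (by omega)
  omega

/-- Keep a ball that does not double, discard its boundary layer, and recurse on the rest. The layer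
is no larger than the ball, and it separates the ball from everything kept later. -/
theorem exists_carving [Finite V] (hV : Nat.card V ≤ 2 ^ b) (G : SimpleGraph V) (X : Set V) :
    ∃ W ⊆ X, X.ncard ≤ 2 * W.ncard ∧ ∃ cent, IsCentering G W b cent := by
  classical
  induction hn : X.ncard using Nat.strong_induction_on generalizing X with
  | _ n ih =>
    subst hn
    obtain rfl | ⟨x, hx⟩ := X.eq_empty_or_nonempty
    · exact ⟨∅, subset_rfl, by simp, id, by simp, by simp⟩
    obtain ⟨r, hr, hcard⟩ := exists_ball_succ_le (G := G) hV hx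
    have hxb : x ∈ ball G X (r + 1) x := self_mem_ball hx
    obtain ⟨W, hWX, hW, cent, hc⟩ := ih _ (Set.ncard_lt_ncard
      (⟨Set.sdiff_subset, fun h => (h hx).2 hxb⟩ : X \ ball G X (r + 1) x ⊂ X)) _ rfl
    have hdisj : ∀ w ∈ W, w ∉ ball G X r x := fun w hw h => (hWX hw).2 (ball_subset_succ h)
    have hnadj : ∀ v ∈ W, ∀ w ∈ ball G X r x, ¬ G.Adj w v := fun v hv w hw h =>
      (hWX hv).2 (mem_ball_succ_of_adj hw (hWX hv).1 h)
    refine ⟨W ∪ ball G X r x, Set.union_subset (hWX.trans Set.sdiff_subset) ball_subset, ?_,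
      fun v => if v ∈ W then cent v else x, ?_, ?_⟩
    · rw [Set.ncard_union_eq (Set.disjoint_left.2 hdisj)]
      have := Set.ncard_le_ncard_sdiff_add_ncard X (ball G X (r + 1) x)
      omega
    · rintro w (hw | hw)
      · simp only [hw, if_true]
        exact ball_mono le_rfl Set.subset_union_left (hc.mem_ball w hw)
      · have : w ∉ W := fun h => hdisj w h hw
        simp only [this, if_false]
        exact ball_mono_radius hr (ball_mono le_rfl Set.subset_union_right
          (ball_subset_ball_ball hw))
    · rintro v (hv | hv) w (hw | hw) hvw
      · simpa [hv, hw] using hc.eq_of_adj v hv w hw hvw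
      · exact absurd hvw.symm (hnadj v hv w hw)
      · exact absurd hvw (hnadj w hw v hv)
      · have h1 : v ∉ W := fun h => hdisj v h hv
        have h2 : w ∉ W := fun h => hdisj w h hw
        simp [h1, h2]

/-- Vertices with a common center have distance at most `2 * r` within their component. -/
theorem IsCentering.ediam_le {r : ℕ} {cent : V → V} (h : IsCentering G W r cent)
    (K : (G.induce W).ConnectedComponent) : K.toSimpleGraph.ediam ≤ ((2 * r : ℕ) : ℕ∞) := by
  have key : ∀ (r : ℕ) (v w : V), w ∈ ball G W r v → ∀ (hv : v ∈ W) (hw : w ∈ W)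
      (hvK : (⟨v, hv⟩ : W) ∈ K), ∃ hwK : (⟨w, hw⟩ : W) ∈ K,
        K.toSimpleGraph.edist ⟨⟨v, hv⟩, hvK⟩ ⟨⟨w, hw⟩, hwK⟩ ≤ (r : ℕ∞) := by
    intro r
    induction r with
    | zero =>
      rintro v w ⟨rfl, -⟩ hv hw hvK
      exact ⟨hvK, by simp⟩
    | succ r ih =>
      rintro v w ⟨-, hb | ⟨x, hx, hb⟩⟩ hv hw hvK
      · obtain ⟨hwK, hd⟩ := ih v w hb hv hw hvK
        exact ⟨hwK, hd.trans (by exact_mod_cast Nat.le_succ r)⟩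
      · have hxW := left_mem_of_mem_ball hb
        have hadj : (G.induce W).Adj ⟨v, hv⟩ ⟨x, hxW⟩ := hx
        have hxK : (⟨x, hxW⟩ : W) ∈ K := by
          rw [← hvK]
          exact (SimpleGraph.ConnectedComponent.eq.2 hadj.reachable).symm
        obtain ⟨hwK, hd⟩ := ih x w hb hxW hw hxK
        refine ⟨hwK, ?_⟩
        have hadj' : K.toSimpleGraph.Adj ⟨⟨v, hv⟩, hvK⟩ ⟨⟨x, hxW⟩, hxK⟩ := hadj
        refine (SimpleGraph.edist_triangle (v := ⟨⟨x, hxW⟩, hxK⟩)).trans ?_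
        rw [SimpleGraph.edist_eq_one_iff_adj.2 hadj']
        push_cast
        rw [add_comm]
        gcongr
  -- The center is constant on a component, so two of its vertices are joined through it by a walk
  -- of length `r + r`.
  have hreach : ∀ x y : W, (G.induce W).Reachable x y → cent x = cent y := by
    rintro x y ⟨p⟩
    induction p with
    | nil => rfl
    | cons hadj _ ih => exact (h.eq_of_adj _ (Subtype.prop _) _ (Subtype.prop _) hadj).trans ih
  rw [SimpleGraph.ediam_le_iff]
  rintro ⟨⟨x, hx⟩, hxK⟩ ⟨⟨y, hy⟩, hyK⟩
  have hxy : cent x = cent y := hreach ⟨x, hx⟩ ⟨y, hy⟩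
    (SimpleGraph.ConnectedComponent.exact (Eq.trans hxK (Eq.symm hyK)))
  have hxc := mem_ball_symm (h.mem_ball x hx)
  have hyc := h.mem_ball y hy
  rw [← hxy] at hyc
  obtain ⟨_, h2⟩ := key (r + r) x y (mem_ball_trans hxc hyc) hx hy hxK
  rwa [two_mul]

end Carving

/-! ### Weak-diameter clustering, bit by bit -/

section Clustering

variable {V : Type*} {bit : V → ℕ → Bool} {b i : ℕ} {lab : V → Option V} {v w ℓ m : V}

open Classical in
/-- A vertex with label `x` whose `i`-th bit is set, and whose neighbors have labels `S`, picks
a label from `S` whose `i`-th bit is not set. -/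
noncomputable def pick (bit : V → ℕ → Bool) (i : ℕ) (x : Option V) (S : Set (Option V)) :
    Option V :=
  if h : (∃ m, x = some m ∧ bit m i = true) ∧ {ℓ | bit ℓ i = false ∧ some ℓ ∈ S}.Nonempty then
    some h.2.some
  else none

/-- The cluster that the vertex `v` asks to join. -/
noncomputable def proposal (G : SimpleGraph V) (bit : V → ℕ → Bool) (i : ℕ)
    (lab : V → Option V) (v : V) : Option V :=
  pick bit i (lab v) (lab '' G.neighborSet v)

/-- The cluster `ℓ` accepts its proposals if they make it grow by a factor of `1 + 1 / (2 * b)`. -/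
def Accepts (G : SimpleGraph V) (bit : V → ℕ → Bool) (b i : ℕ) (lab : V → Option V) (ℓ : V) :
    Prop :=
  {v | lab v = some ℓ}.ncard ≤ 2 * b * {v | proposal G bit i lab v = some ℓ}.ncard

open Classical in
/-- One step of phase `i`: vertices whose proposals are rejected lose their label. -/
noncomputable def step (G : SimpleGraph V) (bit : V → ℕ → Bool) (b i : ℕ)
    (lab : V → Option V) (v : V) : Option V :=
  if proposal G bit i lab v = none then lab v
  else if ∃ ℓ, proposal G bit i lab v = some ℓ ∧ Accepts G bit b i lab ℓ then
    proposal G bit i lab v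
  else none

/-- The number of steps of a phase. -/
def phaseLength (b : ℕ) : ℕ := 2 * b * (b + 1)

/-- The labels after `i` phases. -/
noncomputable def clustering (G : SimpleGraph V) (bit : V → ℕ → Bool) (b : ℕ)
    (lab : V → Option V) : ℕ → V → Option V
  | 0 => lab
  | i + 1 => (step G bit b i)^[phaseLength b] (clustering G bit b lab i)

variable {G : SimpleGraph V}

theorem proposal_spec (h : proposal G bit i lab v = some ℓ) :
    (∃ m, lab v = some m ∧ bit m i = true) ∧ bit ℓ i = false ∧
      ∃ w, G.Adj v w ∧ lab w = some ℓ := by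
  unfold proposal pick at h
  split_ifs at h with h'
  obtain rfl := Option.some.inj h
  obtain ⟨h1, w, hw, hl⟩ := h'.2.some_mem
  exact ⟨h'.1, h1, w, hw, hl⟩

theorem bit_of_proposal_eq_none (h : proposal G bit i lab v = none) (hv : lab v = some m)
    (hm : bit m i = true) (hvw : G.Adj v w) (hw : lab w = some ℓ) : bit ℓ i = true := by
  by_contra hl
  unfold proposal pick at h
  split_ifs at h with h'
  exact h' ⟨⟨m, hv, hm⟩, ℓ, by simpa using hl, w, hvw, hw⟩

theorem step_of_none (h : proposal G bit i lab v = none) : step G bit b i lab v = lab v :=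
  if_pos h

theorem step_of_accepts (h : proposal G bit i lab v = some ℓ) (ha : Accepts G bit b i lab ℓ) :
    step G bit b i lab v = some ℓ := by
  rw [step, if_neg (by simp [h]), if_pos ⟨ℓ, h, ha⟩, h]

theorem step_of_not_accepts (h : proposal G bit i lab v = some ℓ)
    (ha : ¬ Accepts G bit b i lab ℓ) : step G bit b i lab v = none := by
  rw [step, if_neg (by simp [h]), if_neg]
  rintro ⟨ℓ', h', ha'⟩
  rw [h, Option.some_inj] at h'
  exact ha (h' ▸ ha')

theorem step_eq_some (h : step G bit b i lab v = some ℓ) :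
    proposal G bit i lab v = none ∧ lab v = some ℓ ∨
      proposal G bit i lab v = some ℓ ∧ Accepts G bit b i lab ℓ := by
  cases hp : proposal G bit i lab v with
  | none => rw [step_of_none hp] at h; exact Or.inl ⟨rfl, h⟩
  | some ℓ' =>
    by_cases ha : Accepts G bit b i lab ℓ'
    · rw [step_of_accepts hp ha, Option.some_inj] at h
      subst h
      exact Or.inr ⟨rfl, ha⟩
    · simp [step_of_not_accepts hp ha] at h

theorem proposal_of_bit_false (h : lab v = some ℓ) (hl : bit ℓ i = false) :
    proposal G bit i lab v = none := by
  cases hp : proposal G bit i lab v with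
  | none => rfl
  | some ℓ' =>
    obtain ⟨⟨m, hm, hb⟩, -⟩ := proposal_spec hp
    rw [h, Option.some_inj] at hm
    subst hm
    simp [hl] at hb

theorem step_of_bit_false (h : lab v = some ℓ) (hl : bit ℓ i = false) :
    step G bit b i lab v = some ℓ := by
  rw [step_of_none (proposal_of_bit_false h hl), h]

theorem ne_none_of_step_ne_none (h : step G bit b i lab v ≠ none) : lab v ≠ none := by
  obtain ⟨ℓ, hl⟩ := Option.ne_none_iff_exists'.1 h
  obtain ⟨-, h⟩ | ⟨h, -⟩ := step_eq_some hl
  · simp [h]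
  · obtain ⟨⟨m, hm, -⟩, -⟩ := proposal_spec h
    simp [hm]

/-- Only clusters that have just grown receive proposals in the next step. -/
theorem accepts_of_proposal_step (h : proposal G bit i (step G bit b i lab) v = some ℓ) :
    Accepts G bit b i lab ℓ ∧ ∃ u, proposal G bit i lab u = some ℓ := by
  obtain ⟨⟨m, hm, hmb⟩, hl, w, hvw, hw⟩ := proposal_spec h
  obtain ⟨hpv, hv⟩ | ⟨hpv, -⟩ := step_eq_some hm
  · obtain ⟨hpw, hw⟩ | ⟨hpw, ha⟩ := step_eq_some hw
    -- If neither end changed its label, `v` would already have had someone to propose to.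
    · simp [bit_of_proposal_eq_none hpv hv hmb hvw hw] at hl
    · exact ⟨ha, w, hpw⟩
  · simp [(proposal_spec hpv).2.1] at hmb

section Finite

variable [Finite V]

theorem ncard_add_le_ncard_step (hl : bit ℓ i = false) (ha : Accepts G bit b i lab ℓ) :
    {v | lab v = some ℓ}.ncard + {v | proposal G bit i lab v = some ℓ}.ncard ≤
      {v | step G bit b i lab v = some ℓ}.ncard := by
  rw [← Set.ncard_union_eq]
  · refine Set.ncard_le_ncard ?_
    rintro v (hv | hv)
    exacts [step_of_bit_false hv hl, step_of_accepts hv ha]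
  · refine Set.disjoint_left.2 fun v hv hv' => ?_
    have hv' : proposal G bit i lab v = some ℓ := hv'
    simp [proposal_of_bit_false (G := G) hv hl] at hv'

/-- A cluster that still receives proposals has accepted at every earlier step, growing each time by
the factor `1 + 1 / (2 * b)`. -/
theorem pow_le_of_proposal_iterate (t : ℕ)
    (h : proposal G bit i ((step G bit b i)^[t] lab) v = some ℓ) :
    (2 * b + 1) ^ t ≤ (2 * b) ^ t * {v | (step G bit b i)^[t] lab v = some ℓ}.ncard := by
  induction t generalizing v with
  | zero =>
    obtain ⟨-, -, w, -, hw⟩ := proposal_spec h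
    have : 0 < {v | lab v = some ℓ}.ncard := (Set.ncard_pos).2 ⟨w, hw⟩
    simpa using Nat.succ_le_of_lt this
  | succ t ih =>
    rw [Function.iterate_succ_apply'] at h ⊢
    obtain ⟨ha, u, hu⟩ := accepts_of_proposal_step h
    have h1 := ih hu
    have h2 := ncard_add_le_ncard_step (proposal_spec hu).2.1 ha
    rw [Accepts] at ha
    set s := {v | (step G bit b i)^[t] lab v = some ℓ}.ncard
    set p := {v | proposal G bit i ((step G bit b i)^[t] lab) v = some ℓ}.ncard
    set s' := {v | step G bit b i ((step G bit b i)^[t] lab) v = some ℓ}.ncard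
    calc (2 * b + 1) ^ (t + 1) = (2 * b + 1) ^ t * (2 * b + 1) := pow_succ _ _
      _ ≤ (2 * b) ^ t * s * (2 * b + 1) := by gcongr
      _ = (2 * b) ^ t * (2 * b * s + s) := by ring
      _ ≤ (2 * b) ^ t * (2 * b * s + 2 * b * p) := by gcongr
      _ = (2 * b) ^ (t + 1) * (s + p) := by ring
      _ ≤ (2 * b) ^ (t + 1) * s' := by gcongr

/-- Bernoulli's inequality for `(1 + 1 / m) ^ m`. -/
theorem two_mul_pow_self_le {m : ℕ} (hm : 0 < m) : 2 * m ^ m ≤ (m + 1) ^ m := by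
  have hm' : (0 : ℝ) < m := by exact_mod_cast hm
  have h := one_add_mul_le_pow (a := 1 / (m : ℝ)) (by linarith [one_div_pos.2 hm']) m
  have h1 : (m : ℝ) * (1 / m) = 1 := by field_simp
  have h2 : (1 + 1 / (m : ℝ)) * m = m + 1 := by field_simp
  have h3 : (2 : ℝ) * m ^ m ≤ (m + 1) ^ m := by
    rw [← h2, mul_pow]
    gcongr
    linarith
  exact_mod_cast h3

/-- Every `2 * b` accepting steps double a cluster, and `b + 1` doublings exceed `2 ^ b`. -/
theorem proposal_phaseLength (hb : 0 < b) (hV : Nat.card V ≤ 2 ^ b) :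
    proposal G bit i ((step G bit b i)^[phaseLength b] lab) v = none := by
  cases h : proposal G bit i ((step G bit b i)^[phaseLength b] lab) v with
  | none => rfl
  | some ℓ =>
    exfalso
    have h1 := pow_le_of_proposal_iterate _ h
    have h2 : {v | (step G bit b i)^[phaseLength b] lab v = some ℓ}.ncard ≤ 2 ^ b :=
      (Set.ncard_le_card _).trans hV
    have h3 : 2 * (2 * b) ^ (2 * b) ≤ (2 * b + 1) ^ (2 * b) := 
      two_mul_pow_self_le (by omega)
    have h4 : 2 ^ (b + 1) * (2 * b) ^ phaseLength b ≤ (2 * b + 1) ^ phaseLength b := by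
      rw [phaseLength, pow_mul (2 * b), pow_mul (2 * b + 1), ← mul_pow]
      exact Nat.pow_le_pow_left h3 _
    have h5 : 0 < (2 * b) ^ phaseLength b := by positivity
    have h6 : (2 * b) ^ phaseLength b * 2 ^ b < 2 ^ (b + 1) * (2 * b) ^ phaseLength b := by
      rw [mul_comm, pow_succ]
      have : 0 < 2 ^ b := by positivity
      nlinarith [Nat.mul_pos this h5]
    exact absurd (h4.trans (h1.trans (Nat.mul_le_mul_left _ h2))) (by omega)

/-- The members of the clusters that grow in this phase no more. -/
def dormant (G : SimpleGraph V) (bit : V → ℕ → Bool) (i : ℕ) (lab : V → Option V) : Set V :=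
  {v | ∃ ℓ, lab v = some ℓ ∧ bit ℓ i = false ∧ ∀ u, proposal G bit i lab u ≠ some ℓ}

/-- A rejecting cluster has more than `2 * b` members per rejected proposal; sum over these
clusters. -/
theorem mul_ncard_rejected_le :
    2 * b * {v | ∃ ℓ, proposal G bit i lab v = some ℓ ∧ ¬ Accepts G bit b i lab ℓ}.ncard ≤
      {v | ∃ ℓ, lab v = some ℓ ∧ ¬ Accepts G bit b i lab ℓ ∧
        ∃ u, proposal G bit i lab u = some ℓ}.ncard := by
  classical
  have := Fintype.ofFinite V
  let L : Finset V := Finset.univ.filter fun ℓ =>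
    ¬ Accepts G bit b i lab ℓ ∧ ∃ u, proposal G bit i lab u = some ℓ
  have h1 : {v | ∃ ℓ, proposal G bit i lab v = some ℓ ∧ ¬ Accepts G bit b i lab ℓ} =
      ((L.biUnion fun ℓ => Finset.univ.filter fun v => proposal G bit i lab v = some ℓ :
        Finset V) : Set V) := by
    ext v
    simp only [L, Set.mem_ofPred_eq, Finset.coe_biUnion, Finset.coe_filter, Set.mem_iUnion,
      Finset.mem_univ, true_and, exists_prop]
    exact ⟨fun ⟨ℓ, h, h'⟩ => ⟨ℓ, ⟨h', v, h⟩, h⟩, fun ⟨ℓ, h, h'⟩ => ⟨ℓ, h', h.1⟩⟩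
  have h2 : {v | ∃ ℓ, lab v = some ℓ ∧ ¬ Accepts G bit b i lab ℓ ∧
        ∃ u, proposal G bit i lab u = some ℓ} =
      ((L.biUnion fun ℓ => Finset.univ.filter fun v => lab v = some ℓ : Finset V) : Set V) := by
    ext v
    simp only [L, Set.mem_ofPred_eq, Finset.coe_biUnion, Finset.coe_filter, Set.mem_iUnion,
      Finset.mem_univ, true_and, exists_prop]
    exact ⟨fun ⟨ℓ, h, h'⟩ => ⟨ℓ, h', h⟩, fun ⟨ℓ, h, h'⟩ => ⟨ℓ, h', h⟩⟩
  rw [h1, h2, Set.ncard_coe_finset, Set.ncard_coe_finset, Finset.card_biUnion,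
    Finset.card_biUnion, Finset.mul_sum]
  · refine Finset.sum_le_sum fun ℓ hℓ => ?_
    have hr := (Finset.mem_filter.1 hℓ).2.1
    rw [Accepts, not_le, ← Finset.coe_filter_univ, ← Finset.coe_filter_univ,
      Set.ncard_coe_finset, Set.ncard_coe_finset] at hr
    exact hr.le
  · intro x _ y _ hxy
    rw [Function.onFun, Finset.disjoint_left]
    intro v hv hv'
    simp only [Finset.mem_filter, Finset.mem_univ, true_and] at hv hv'
    exact hxy (Option.some.inj (hv.symm.trans hv'))
  · intro x _ y _ hxy
    rw [Function.onFun, Finset.disjoint_left]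
    intro v hv hv'
    simp only [Finset.mem_filter, Finset.mem_univ, true_and] at hv hv'
    exact hxy (Option.some.inj (hv.symm.trans hv'))

/-- The left side is a potential that never decreases. Each dropped vertex is charged to `2 * b`
members of the cluster that rejected it; that cluster turns dormant and stays so, hence pays once
per phase. -/
theorem live_add_dormant_le :
    2 * b * {v | lab v ≠ none}.ncard + (dormant G bit i lab).ncard ≤
      2 * b * {v | step G bit b i lab v ≠ none}.ncard +
        (dormant G bit i (step G bit b i lab)).ncard := by
  set K := {v | ∃ ℓ, proposal G bit i lab v = some ℓ ∧ ¬ Accepts G bit b i lab ℓ}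
  set M := {v | ∃ ℓ, lab v = some ℓ ∧ ¬ Accepts G bit b i lab ℓ ∧
    ∃ u, proposal G bit i lab u = some ℓ}
  have hKM : 2 * b * K.ncard ≤ M.ncard := mul_ncard_rejected_le
  have h1 : {v | lab v ≠ none}.ncard ≤ {v | step G bit b i lab v ≠ none}.ncard + K.ncard := by
    refine (Set.ncard_le_ncard ?_).trans (Set.ncard_union_le _ _)
    intro v hv
    cases hp : proposal G bit i lab v with
    | none => exact Or.inl (by simpa [step_of_none hp] using hv)
    | some ℓ =>
      by_cases ha : Accepts G bit b i lab ℓ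
      · exact Or.inl (by simp [step_of_accepts hp ha])
      · exact Or.inr ⟨ℓ, hp, ha⟩
  have h2 : (dormant G bit i lab).ncard + M.ncard ≤
      (dormant G bit i (step G bit b i lab)).ncard := by
    rw [← Set.ncard_union_eq]
    · refine Set.ncard_le_ncard ?_
      rintro v (⟨ℓ, hv, hl, hu⟩ | ⟨ℓ, hv, ha, u, hu⟩)
      · exact ⟨ℓ, step_of_bit_false hv hl, hl, fun u h =>
          let ⟨u', hu'⟩ := (accepts_of_proposal_step h).2
          hu u' hu'⟩
      · have hl := (proposal_spec hu).2.1
        exact ⟨ℓ, step_of_bit_false hv hl, hl, fun u h => ha (accepts_of_proposal_step h).1⟩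
    · rw [Set.disjoint_left]
      rintro v ⟨ℓ, hv, -, hu⟩ ⟨ℓ', hv', -, u, hu'⟩
      rw [hv, Option.some_inj] at hv'
      exact hu u (hv' ▸ hu')
  calc _ ≤ 2 * b * ({v | step G bit b i lab v ≠ none}.ncard + K.ncard) +
        (dormant G bit i lab).ncard := by gcongr
    _ ≤ _ := by rw [mul_add]; omega

/-- The dormant part of the potential stays at most the initial number of labeled vertices, so a
phase loses at most a `1 / (2 * b)` fraction. -/
theorem live_phase_le (t : ℕ) :
    2 * b * {v | lab v ≠ none}.ncard ≤
        2 * b * {v | (step G bit b i)^[t] lab v ≠ none}.ncard + {v | lab v ≠ none}.ncard ∧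
      {v | (step G bit b i)^[t] lab v ≠ none} ⊆ {v | lab v ≠ none} := by
  have hsub : {v | (step G bit b i)^[t] lab v ≠ none} ⊆ {v | lab v ≠ none} := by
    induction t with
    | zero => exact subset_rfl
    | succ t ih =>
      rw [Function.iterate_succ_apply']
      exact fun v hv => ih (ne_none_of_step_ne_none hv)
  have hd : (dormant G bit i ((step G bit b i)^[t] lab)).ncard ≤ {v | lab v ≠ none}.ncard := by
    refine Set.ncard_le_ncard fun v ⟨ℓ, hv, _⟩ => hsub ?_
    simp [hv]
  have key : 2 * b * {v | lab v ≠ none}.ncard ≤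
      2 * b * {v | (step G bit b i)^[t] lab v ≠ none}.ncard +
        (dormant G bit i ((step G bit b i)^[t] lab)).ncard := by
    clear hd hsub
    induction t with
    | zero => exact Nat.le_add_right _ _
    | succ t ih =>
      rw [Function.iterate_succ_apply']
      exact ih.trans live_add_dormant_le
  exact ⟨key.trans (by gcongr), hsub⟩

theorem live_clustering_le (k : ℕ) :
    2 * b * {v | lab v ≠ none}.ncard ≤
        2 * b * {v | clustering G bit b lab k v ≠ none}.ncard + k * {v | lab v ≠ none}.ncard ∧
      {v | clustering G bit b lab k v ≠ none} ⊆ {v | lab v ≠ none} := by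
  induction k with
  | zero => exact ⟨by simp [clustering], subset_rfl⟩
  | succ k ih =>
    obtain ⟨h1, h2⟩ := live_phase_le (G := G) (bit := bit) (b := b) (i := k)
      (lab := clustering G bit b lab k) (phaseLength b)
    refine ⟨?_, h2.trans ih.2⟩
    have h3 := Set.ncard_le_ncard ih.2
    have h4 := ih.1
    rw [add_mul, one_mul]
    change _ ≤ 2 * b * {v | (step G bit b k)^[phaseLength b] (clustering G bit b lab k) v
      ≠ none}.ncard + _
    omega

end Finite

/-- Adjacent clusters have labels with the same first `i` bits. -/
def Agree (G : SimpleGraph V) (bit : V → ℕ → Bool) (i : ℕ) (lab : V → Option V) : Prop :=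
  ∀ ⦃v w ℓ m⦄, G.Adj v w → lab v = some ℓ → lab w = some m → ∀ j < i, bit ℓ j = bit m j

/-- A new label is copied from a neighbor, and it agreed with the old label on the earlier bits. -/
theorem Agree.step (h : Agree G bit i lab) : Agree G bit i (step G bit b i lab) := by
  have key : ∀ v ℓ, LocalModel.step G bit b i lab v = some ℓ →
      ∃ ℓ', lab v = some ℓ' ∧ ∀ j < i, bit ℓ j = bit ℓ' j := by
    intro v ℓ hv
    obtain ⟨-, hv⟩ | ⟨hp, -⟩ := step_eq_some hv
    · exact ⟨ℓ, hv, fun _ _ => rfl⟩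
    · obtain ⟨⟨m, hm, -⟩, -, w, hvw, hw⟩ := proposal_spec hp
      exact ⟨m, hm, h hvw.symm hw hm⟩
  intro v w ℓ m hvw hv hw j hj
  obtain ⟨ℓ', hv', h1⟩ := key v ℓ hv
  obtain ⟨m', hw', h2⟩ := key w m hw
  rw [h1 j hj, h2 j hj, h hvw hv' hw' j hj]

/-- An edge whose labels differ in bit `k` would cause a proposal, but none is left after phase `k`.
-/
theorem agree_clustering [Finite V] (hb : 0 < b) (hV : Nat.card V ≤ 2 ^ b) (k : ℕ) :
    Agree G bit k (clustering G bit b lab k) := by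
  induction k with
  | zero => intro v w ℓ m _ _ _ j hj; omega
  | succ k ih =>
    have h1 : ∀ t, Agree G bit k ((step G bit b k)^[t] (clustering G bit b lab k)) := by
      intro t
      induction t with
      | zero => exact ih
      | succ t ih' => rw [Function.iterate_succ_apply']; exact ih'.step
    have h2 := fun v => proposal_phaseLength (G := G) (bit := bit) (i := k)
      (lab := clustering G bit b lab k) (v := v) hb hV
    intro v w ℓ m hvw hv hw j hj
    obtain hj | rfl := Nat.lt_succ_iff_lt_or_eq.1 hj
    · exact h1 _ hvw hv hw j hj
    · cases hl : bit ℓ j with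
      | true => exact (bit_of_proposal_eq_none (h2 v) hv hl hvw hw).symm
      | false =>
        cases hm : bit m j with
        | false => rfl
        | true => simp [bit_of_proposal_eq_none (h2 w) hw hm hvw.symm hv] at hl

/-- Every vertex is within distance `s` of the vertex that its label names. -/
def Close (G : SimpleGraph V) (s : ℕ) (lab : V → Option V) : Prop :=
  ∀ ⦃v ℓ⦄, lab v = some ℓ → ℓ ∈ ball G Set.univ s v

theorem mem_ball_of_proposal {s : ℕ} (h : Close G s lab) (hp : proposal G bit i lab v = some ℓ) :
    ℓ ∈ ball G Set.univ (s + 1) v := by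
  obtain ⟨-, -, w, hvw, hw⟩ := proposal_spec hp
  exact ⟨trivial, Or.inr ⟨w, hvw, h hw⟩⟩

/-- Joining means copying a neighbor's label, which costs one unit of distance. Walks use all of
`G`: intermediate vertices may have lost their labels. -/
theorem Close.step {s : ℕ} (h : Close G s lab) : Close G (s + 1) (step G bit b i lab) := by
  intro v ℓ hv
  obtain ⟨-, hv⟩ | ⟨hp, -⟩ := step_eq_some hv
  · exact ball_subset_succ (h hv)
  · exact mem_ball_of_proposal h hp

theorem Close.iterate {s : ℕ} (h : Close G s lab) (t : ℕ) :
    Close G (s + t) ((LocalModel.step G bit b i)^[t] lab) := by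
  induction t with
  | zero => exact h
  | succ t ih => rw [Function.iterate_succ_apply']; exact ih.step

theorem Close.clustering (h : Close G 0 lab) (k : ℕ) :
    Close G (k * phaseLength b) (clustering G bit b lab k) := by
  induction k with
  | zero => simpa [LocalModel.clustering] using h
  | succ k ih => rw [Nat.succ_mul]; exact ih.iterate _

end Clustering

/-! ### Carving every cluster -/

section Carved

variable {V : Type*} {G : SimpleGraph V} {b : ℕ} {lab : V → Option V}

/-- The edges of `G` between vertices of `X`. -/
def inside (G : SimpleGraph V) (X : Set V) : SimpleGraph V :=
  SimpleGraph.fromRel fun v w => v ∈ X ∧ w ∈ X ∧ G.Adj v w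

theorem inside_le {X : Set V} : inside G X ≤ G := by
  rintro v w ⟨-, ⟨-, -, h⟩ | ⟨-, -, h⟩⟩
  exacts [h, h.symm]

theorem inside_adj {X : Set V} {v w : V} (hv : v ∈ X) (hw : w ∈ X) (h : G.Adj v w) :
    (inside G X).Adj v w :=
  ⟨h.ne, Or.inl ⟨hv, hw, h⟩⟩

/-- At least half of `X`, chosen so that its components in `H` have radius at most `b`. -/
noncomputable def carving (b : ℕ) (H : SimpleGraph V) (X : Set V) : Set V :=
  Classical.epsilon fun W => W ⊆ X ∧ X.ncard ≤ 2 * W.ncard ∧ ∃ cent, IsCentering H W b cent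

theorem carving_spec [Finite V] (hV : Nat.card V ≤ 2 ^ b) (H : SimpleGraph V) (X : Set V) :
    carving b H X ⊆ X ∧ X.ncard ≤ 2 * (carving b H X).ncard ∧
      ∃ cent, IsCentering H (carving b H X) b cent :=
  Classical.epsilon_spec (exists_carving hV H X)

/-- The union of the carvings of all clusters. -/
def carved (G : SimpleGraph V) (b : ℕ) (lab : V → Option V) : Set V :=
  {v | ∃ ℓ, lab v = some ℓ ∧
    v ∈ carving b (inside G {w | lab w = some ℓ}) {w | lab w = some ℓ}}

theorem carved_subset : carved G b lab ⊆ {v | lab v ≠ none} := by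
  rintro v ⟨ℓ, h, -⟩
  simp [h]

theorem ncard_eq_sum_fibers [Fintype V] {S : Set V} (hS : S ⊆ {v | lab v ≠ none}) :
    S.ncard = ∑ ℓ, (S ∩ {v | lab v = some ℓ}).ncard := by
  rw [← finsum_eq_sum_of_fintype, ← Set.ncard_iUnion_of_finite]
  · congr 1
    ext v
    simp only [Set.mem_iUnion]
    exact ⟨fun hv => (Option.ne_none_iff_exists'.1 (hS hv)).imp fun ℓ h => ⟨hv, h⟩,
      fun ⟨_, h⟩ => h.1⟩
  · exact fun _ => Set.toFinite _
  · intro x y hxy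
    refine Set.disjoint_left.2 fun v hv hv' => hxy (Option.some.inj (hv.2.symm.trans hv'.2))

theorem ncard_live_le_two_mul_carved [Finite V] (hV : Nat.card V ≤ 2 ^ b) :
    {v | lab v ≠ none}.ncard ≤ 2 * (carved G b lab).ncard := by
  have := Fintype.ofFinite V
  rw [ncard_eq_sum_fibers subset_rfl, ncard_eq_sum_fibers (carved_subset (lab := lab)),
    Finset.mul_sum]
  refine Finset.sum_le_sum fun ℓ _ => ?_
  obtain ⟨h1, h2, -⟩ := carving_spec hV (inside G {w | lab w = some ℓ}) {w | lab w = some ℓ}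
  have h3 : carving b (inside G {w | lab w = some ℓ}) {w | lab w = some ℓ} ⊆
      carved G b lab ∩ {w | lab w = some ℓ} := fun v hv => ⟨⟨ℓ, h1 hv, hv⟩, h1 hv⟩
  exact (Set.ncard_le_ncard Set.inter_subset_right).trans
    (h2.trans (Nat.mul_le_mul_left _ (Set.ncard_le_ncard h3)))

/-- Clusters are pairwise nonadjacent, so their separate centerings glue together. -/
theorem exists_isCentering_carved [Finite V] (hV : Nat.card V ≤ 2 ^ b)
    (hlab : ∀ v w ℓ m, G.Adj v w → lab v = some ℓ → lab w = some m → ℓ = m) :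
    ∃ cent, IsCentering G (carved G b lab) b cent := by
  choose h1 _ c hc using fun ℓ =>
    carving_spec hV (inside G {w | lab w = some ℓ}) {w | lab w = some ℓ}
  -- The default is never used on carved vertices, as these have labels.
  refine ⟨fun v => c ((lab v).getD v) v, ?_, ?_⟩
  · rintro v ⟨ℓ, hv, hm⟩
    simp only [hv, Option.getD_some]
    have h2 : carving b (inside G {w | lab w = some ℓ}) {w | lab w = some ℓ} ⊆
        carved G b lab := fun w hw => ⟨ℓ, h1 ℓ hw, hw⟩
    exact ball_mono inside_le h2 ((hc ℓ).mem_ball v hm)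
  · rintro v ⟨ℓ, hv, hvm⟩ w ⟨m, hw, hwm⟩ hvw
    obtain rfl := hlab v w ℓ m hvw hv hw
    simp only [hv, hw, Option.getD_some]
    exact (hc ℓ).eq_of_adj v hvm w hwm (inside_adj hv hw hvw)

end Carved

/-! ### Iterating over the colors -/

section Decomposition

variable {V : Type*} {G : SimpleGraph V} {bit : V → ℕ → Bool} {b : ℕ}

open Classical in
/-- Each vertex of `U` starts as a cluster of its own. -/
noncomputable def initialLabel (U : Set V) (v : V) : Option V := if v ∈ U then some v else none

theorem live_initialLabel (U : Set V) : {v | initialLabel U v ≠ none} = U := by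
  ext v
  simp [initialLabel]

theorem close_initialLabel (U : Set V) : Close G 0 (initialLabel U) := by
  intro v ℓ h
  unfold initialLabel at h
  split_ifs at h
  exact ⟨(Option.some.inj h).symm, trivial⟩

/-- The labels of the clusters formed within `U`. -/
noncomputable def clusterLabel (G : SimpleGraph V) (bit : V → ℕ → Bool) (b : ℕ) (U : Set V) :
    V → Option V :=
  clustering G bit b (initialLabel U) b

/-- The vertices that have no color among the first `j`. -/
noncomputable def remaining (G : SimpleGraph V) (bit : V → ℕ → Bool) (b : ℕ) : ℕ → Set V
  | 0 => Set.univ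
  | j + 1 => remaining G bit b j \ carved G b (clusterLabel G bit b (remaining G bit b j))

/-- The color of a vertex. -/
noncomputable def color (G : SimpleGraph V) (bit : V → ℕ → Bool) (b : ℕ) (v : V) : ℕ :=
  sInf {j | j < 3 * b ∧ v ∉ remaining G bit b (j + 1)}

theorem remaining_antitone : Antitone (remaining G bit b) :=
  antitone_nat_of_succ_le fun _ => Set.sdiff_subset

variable [Finite V]

theorem carved_clusterLabel_subset (U : Set V) :
    carved G b (clusterLabel G bit b U) ⊆ U :=
  (carved_subset.trans (live_clustering_le b).2).trans (live_initialLabel U).le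

/-- One factor two is lost in the clustering, one in the carving. -/
theorem ncard_le_four_mul_carved (hb : 0 < b) (hV : Nat.card V ≤ 2 ^ b) (U : Set V) :
    U.ncard ≤ 4 * (carved G b (clusterLabel G bit b U)).ncard := by
  have h1 := (live_clustering_le (G := G) (bit := bit) (b := b) (lab := initialLabel U) b).1
  have h2 := ncard_live_le_two_mul_carved (G := G) (lab := clusterLabel G bit b U) hV
  rw [live_initialLabel] at h1
  change _ ≤ 2 * b * {v | clusterLabel G bit b U v ≠ none}.ncard + _ at h1
  have h3 : U.ncard ≤ 2 * {v | clusterLabel G bit b U v ≠ none}.ncard := by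
    refine Nat.le_of_mul_le_mul_left (?_ : b * _ ≤ b * _) hb
    linarith
  omega

theorem four_pow_mul_ncard_remaining_le (hb : 0 < b) (hV : Nat.card V ≤ 2 ^ b) (j : ℕ) :
    4 ^ j * (remaining G bit b j).ncard ≤ 3 ^ j * 2 ^ b := by
  induction j with
  | zero => simpa using (Set.ncard_le_card _).trans hV
  | succ j ih =>
    have h1 := ncard_le_four_mul_carved (G := G) (bit := bit) hb hV (remaining G bit b j)
    have h2 : (remaining G bit b (j + 1)).ncard +
        (carved G b (clusterLabel G bit b (remaining G bit b j))).ncard =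
        (remaining G bit b j).ncard :=
      Set.ncard_sdiff_add_ncard_of_subset (carved_clusterLabel_subset _)
    calc 4 ^ (j + 1) * (remaining G bit b (j + 1)).ncard
        = 4 ^ j * (4 * (remaining G bit b (j + 1)).ncard) := by ring
      _ ≤ 4 ^ j * (3 * (remaining G bit b j).ncard) := by gcongr 4 ^ j * ?_; omega
      _ = 3 * (4 ^ j * (remaining G bit b j).ncard) := by ring
      _ ≤ 3 * (3 ^ j * 2 ^ b) := by gcongr
      _ = 3 ^ (j + 1) * 2 ^ b := by ring

theorem remaining_eq_empty (hb : 0 < b) (hV : Nat.card V ≤ 2 ^ b) :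
    remaining G bit b (3 * b) = ∅ := by
  have h := four_pow_mul_ncard_remaining_le (G := G) (bit := bit) hb hV (3 * b)
  rw [pow_mul, pow_mul, ← mul_pow] at h
  -- Three colors per bit suffice because `54 < 64`.
  have h2 : ((3 ^ 3 * 2) ^ b : ℕ) < (4 ^ 3) ^ b := Nat.pow_lt_pow_left (by norm_num) hb.ne'
  rw [← Set.ncard_eq_zero]
  by_contra h0
  have := Nat.le_mul_of_pos_right ((4 ^ 3) ^ b) (Nat.pos_of_ne_zero h0)
  omega

theorem color_spec (hb : 0 < b) (hV : Nat.card V ≤ 2 ^ b) (v : V) :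
    color G bit b v < 3 * b ∧ v ∉ remaining G bit b (color G bit b v + 1) := by
  refine Nat.sInf_mem (s := {j | j < 3 * b ∧ v ∉ remaining G bit b (j + 1)}) ⟨3 * b - 1, ?_⟩
  refine ⟨by omega, ?_⟩
  rw [Nat.sub_add_cancel (by omega), remaining_eq_empty hb hV]
  exact Set.notMem_empty v

theorem setOf_color_eq (hb : 0 < b) (hV : Nat.card V ≤ 2 ^ b) {j : ℕ} (hj : j < 3 * b) :
    {v | color G bit b v = j} = carved G b (clusterLabel G bit b (remaining G bit b j)) := by
  ext v
  constructor
  · rintro rfl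
    obtain ⟨h1, h2⟩ := color_spec (G := G) (bit := bit) hb hV v
    by_contra h
    refine h2 ⟨?_, h⟩
    rcases hc : color G bit b v with _ | c
    · trivial
    · by_contra h3
      have : color G bit b v ≤ c := Nat.sInf_le ⟨by omega, h3⟩
      omega
  · intro hv
    have h1 := carved_clusterLabel_subset _ hv
    have h2 : v ∉ remaining G bit b (j + 1) := fun h => h.2 hv
    refine le_antisymm (Nat.sInf_le ⟨hj, h2⟩) ?_
    by_contra! h3
    exact (color_spec (G := G) (bit := bit) hb hV v).2 (remaining_antitone h3 h1)

theorem exists_isCentering_color (hb : 0 < b) (hV : Nat.card V ≤ 2 ^ b)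
    (hbit : ∀ v w : V, (∀ j < b, bit v j = bit w j) → v = w) {j : ℕ} (hj : j < 3 * b) :
    ∃ cent, IsCentering G {v | color G bit b v = j} b cent := by
  rw [setOf_color_eq hb hV hj]
  exact exists_isCentering_carved hV fun v w ℓ m hvw hv hw =>
    hbit ℓ m (agree_clustering hb hV b hvw hv hw)

end Decomposition

/-! ### Round complexity through views -/

section Locality

/-- What a node can know after the given number of rounds. -/
def View : ℕ → Type
  | 0 => ℕ
  | t + 1 => View t × Set (View t)

variable {V : Type*}

/-- What `v` knows after the given number of rounds. -/
def view (ident : V → ℕ) (G : SimpleGraph V) : (t : ℕ) → V → View t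
  | 0, v => ident v
  | t + 1, v => (view ident G t v, view ident G t '' G.neighborSet v)

/-- The function `φ` of networks and their vertices can be computed in `T` rounds. -/
def IsLocal {α : Type*} (ident : V → ℕ) (T : ℕ) (φ : SimpleGraph V → V → α) : Prop :=
  ∃ F : View T → α, ∀ G v, φ G v = F (view ident G T v)

namespace IsLocal

variable {α β : Type*} {ident : V → ℕ} {T T' : ℕ} {φ : SimpleGraph V → V → α}
  {ψ : SimpleGraph V → V → β}

theorem const (a : α) : IsLocal ident T fun _ _ => a := ⟨fun _ => a, fun _ _ => rfl⟩

/-- Distinct identifiers let a view name its vertex, so local functions may speak about vertices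
directly. -/
theorem self [Nonempty V] (h : Function.Injective ident) : IsLocal ident 0 fun _ v => v :=
  ⟨Function.invFun ident, fun _ v => (Function.leftInverse_invFun h v).symm⟩

theorem congr {φ' : SimpleGraph V → V → α} (h : IsLocal ident T φ)
    (h' : ∀ G v, φ' G v = φ G v) : IsLocal ident T φ' :=
  let ⟨F, hF⟩ := h
  ⟨F, fun G v => (h' G v).trans (hF G v)⟩

theorem comp (h : IsLocal ident T φ) (g : α → β) : IsLocal ident T fun G v => g (φ G v) :=
  let ⟨F, hF⟩ := h
  ⟨fun x => g (F x), fun G v => congrArg g (hF G v)⟩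

theorem pair (h : IsLocal ident T φ) (h' : IsLocal ident T ψ) :
    IsLocal ident T fun G v => (φ G v, ψ G v) :=
  let ⟨F, hF⟩ := h
  let ⟨F', hF'⟩ := h'
  ⟨fun x => (F x, F' x), fun G v => Prod.ext (hF G v) (hF' G v)⟩

theorem pi {ι : Type*} {φ : ι → SimpleGraph V → V → α} (h : ∀ i, IsLocal ident T (φ i)) :
    IsLocal ident T fun G v i => φ i G v := by
  choose F hF using h
  exact ⟨fun x i => F i x, fun G v => funext fun i => hF i G v⟩

theorem mono (h : IsLocal ident T φ) (hT : T ≤ T') : IsLocal ident T' φ := by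
  induction hT with
  | refl => exact h
  | step _ ih =>
    obtain ⟨F, hF⟩ := ih
    exact ⟨fun x => F x.1, hF⟩

theorem neighbors (h : IsLocal ident T φ) :
    IsLocal ident (T + 1) fun G v => φ G '' G.neighborSet v := by
  obtain ⟨F, hF⟩ := h
  refine ⟨fun x => F '' x.2, fun G v => ?_⟩
  refine Eq.trans ?_ (Set.image_image F (view ident G T) (G.neighborSet v)).symm
  exact Set.image_congr fun w _ => hF G w

theorem ball (h : IsLocal ident T φ) (r : ℕ) :
    IsLocal ident (T + r) fun G v => φ G '' LocalModel.ball G Set.univ r v := by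
  induction r with
  | zero =>
    refine (h.comp fun x => ({x} : Set α)).congr fun G v => ?_
    ext a
    simp [LocalModel.ball, eq_comm]
  | succ r ih =>
    refine (((ih.mono (Nat.le_succ _)).pair ih.neighbors).comp
      fun x => x.1 ∪ ⋃₀ x.2).congr fun G v => ?_
    ext a
    simp only [LocalModel.ball, Set.mem_univ, true_and, Set.sUnion_image, Set.mem_union,
      Set.mem_iUnion, Set.mem_image, Set.mem_ofPred_eq, SimpleGraph.mem_neighborSet]
    constructor
    · rintro ⟨w, h | ⟨x, hx, h⟩, rfl⟩
      exacts [Or.inl ⟨w, h, rfl⟩, Or.inr ⟨x, hx, w, h, rfl⟩]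
    · rintro (⟨w, h, rfl⟩ | ⟨x, hx, w, h, rfl⟩)
      exacts [⟨w, Or.inl h, rfl⟩, ⟨w, Or.inr ⟨x, hx, h⟩, rfl⟩]

end IsLocal

variable {ident : V → ℕ} {T s L b i : ℕ} {bit : V → ℕ → Bool}
  {lab : SimpleGraph V → V → Option V}

theorem isLocal_proposal (h : IsLocal ident T lab) :
    IsLocal ident (T + 1) fun G v => proposal G bit i (lab G) v :=
  ((h.mono (Nat.le_succ _)).pair h.neighbors).comp fun x => pick bit i x.1 x.2

variable [Nonempty V]

open Classical in
-- To decide acceptance, `v` counts the members and proposers of `ℓ`. All of them, and `v` itself,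
-- lie within `s + 1` of `ℓ`, hence in the ball of radius `L` around `v`.
theorem isLocal_step (hid : Function.Injective ident) (h : IsLocal ident T lab)
    (hs : ∀ G, Close G s (lab G)) (hL : 2 * (s + 1) ≤ L) :
    IsLocal ident (T + 1 + L) fun G v => step G bit b i (lab G) v := by
  have h1 := isLocal_proposal (bit := bit) (i := i) h
  have h2 := h.mono (Nat.le_succ T)
  have h3 := (((IsLocal.self hid).mono (Nat.zero_le _)).pair (h2.pair h1)).ball L
  refine ((((h2.mono (Nat.le_add_right _ L)).pair
    (h1.mono (Nat.le_add_right _ L))).pair h3).comp fun x =>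
      if x.1.2 = none then x.1.1
      else if ∃ ℓ, x.1.2 = some ℓ ∧ {w | ∃ y, (w, some ℓ, y) ∈ x.2}.ncard ≤
        2 * b * {w | ∃ y, (w, y, some ℓ) ∈ x.2}.ncard then x.1.2
      else none).congr fun G v => ?_
  unfold step
  refine if_congr Iff.rfl rfl (if_congr (exists_congr fun ℓ => and_congr_right fun hv => ?_)
    rfl rfl)
  have hball : ∀ w, ℓ ∈ ball G Set.univ (s + 1) w → w ∈ ball G Set.univ L v := fun w hw =>
    ball_mono_radius (by omega)
      (mem_ball_trans (mem_ball_of_proposal (hs G) hv) (mem_ball_symm hw))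
  have e1 : {w | lab G w = some ℓ} = {w | ∃ y, (w, some ℓ, y) ∈
      (fun w => (w, lab G w, proposal G bit i (lab G) w)) '' ball G Set.univ L v} := by
    ext w
    constructor
    · intro hw
      have hw' : lab G w = some ℓ := hw
      exact ⟨proposal G bit i (lab G) w, w, hball w (ball_subset_succ (hs G hw)), by simp [hw']⟩
    · rintro ⟨y, u, -, hu⟩
      simp only [Prod.mk.injEq] at hu
      obtain ⟨rfl, hu, -⟩ := hu
      exact hu
  have e2 : {w | proposal G bit i (lab G) w = some ℓ} = {w | ∃ y, (w, y, some ℓ) ∈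
      (fun w => (w, lab G w, proposal G bit i (lab G) w)) '' ball G Set.univ L v} := by
    ext w
    constructor
    · intro hw
      have hw' : proposal G bit i (lab G) w = some ℓ := hw
      exact ⟨lab G w, w, hball w (mem_ball_of_proposal (hs G) hw), by simp [hw']⟩
    · rintro ⟨y, u, -, hu⟩
      simp only [Prod.mk.injEq] at hu
      obtain ⟨rfl, -, hu⟩ := hu
      exact hu
  rw [Accepts, e1, e2]

theorem isLocal_iterate_step (hid : Function.Injective ident) (h : IsLocal ident T lab)
    (hs : ∀ G, Close G s (lab G)) (t : ℕ) (hL : 2 * (s + t) ≤ L) :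
    IsLocal ident (T + t * (L + 1)) fun G => (step G bit b i)^[t] (lab G) := by
  induction t with
  | zero => simpa using h
  | succ t ih =>
    have := isLocal_step (bit := bit) (b := b) (i := i) (L := L) hid (ih (by omega))
      (fun G => (hs G).iterate t) (by omega)
    simp only [Function.iterate_succ_apply']
    exact this.mono (by rw [add_mul]; omega)

theorem isLocal_clustering (hid : Function.Injective ident) (h : IsLocal ident T lab)
    (hs : ∀ G, Close G 0 (lab G)) (k : ℕ) (hL : 2 * (k * phaseLength b) ≤ L) :
    IsLocal ident (T + k * phaseLength b * (L + 1)) fun G => clustering G bit b (lab G) k := by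
  induction k with
  | zero => simpa [clustering] using h
  | succ k ih =>
    rw [Nat.add_mul, one_mul] at hL
    have := isLocal_iterate_step (bit := bit) (b := b) (i := k) (L := L) hid (ih (by omega))
      (fun G => (hs G).clustering k) (phaseLength b) hL
    exact this.mono (by rw [Nat.succ_mul, add_mul]; omega)

/-- Every member sees its entire cluster and reconstructs the same graph on it. As `carving` is a
fixed choice depending only on that data, all members agree without further communication. -/
theorem isLocal_carved (hid : Function.Injective ident) (h : IsLocal ident T lab)
    (hs : ∀ G, Close G s (lab G)) (hL : 2 * s ≤ L) :
    IsLocal ident (T + 1 + L) fun G v => v ∈ carved G b (lab G) := by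
  have h0 : IsLocal ident T fun _ v => v := (IsLocal.self hid).mono (Nat.zero_le _)
  have h3 := ((h0.mono (Nat.le_succ _)).pair ((h.mono (Nat.le_succ T)).pair h0.neighbors)).ball L
  rw [add_assoc]
  refine ((((h0.pair h).mono (Nat.le_add_right T (1 + L))).pair
    (h3.mono (by omega : _ ≤ T + (1 + L)))).comp fun x =>
      ∃ ℓ, x.1.2 = some ℓ ∧ x.1.1 ∈ carving b
        -- The graph `inside G` of the cluster, rebuilt from gathered triples of vertex, label and
        -- neighbor set.
        (SimpleGraph.fromRel fun v w => v ∈ {w | ∃ y, (w, some ℓ, y) ∈ x.2} ∧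
          w ∈ {w | ∃ y, (w, some ℓ, y) ∈ x.2} ∧ ∃ y, (v, some ℓ, y) ∈ x.2 ∧ w ∈ y)
        {w | ∃ y, (w, some ℓ, y) ∈ x.2}).congr fun G v => ?_
  refine propext (exists_congr fun ℓ => and_congr_right fun hv => ?_)
  have hball : ∀ w, lab G w = some ℓ → w ∈ ball G Set.univ L v := fun w hw =>
    ball_mono_radius (by omega) (mem_ball_trans (hs G hv) (mem_ball_symm (hs G hw)))
  have e1 : {w | ∃ y, (w, some ℓ, y) ∈
      (fun w => (w, lab G w, (fun v => v) '' G.neighborSet w)) '' ball G Set.univ L v} =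
      {w | lab G w = some ℓ} := by
    ext w
    constructor
    · rintro ⟨y, u, -, hu⟩
      simp only [Prod.mk.injEq] at hu
      obtain ⟨rfl, hu, -⟩ := hu
      exact hu
    · intro hw
      have hw' : lab G w = some ℓ := hw
      exact ⟨(fun v => v) '' G.neighborSet w, w, hball w hw, by simp only [hw']⟩
  have e2 : inside G {w | lab G w = some ℓ} =
      SimpleGraph.fromRel fun v' w' => v' ∈ {w | lab G w = some ℓ} ∧
          w' ∈ {w | lab G w = some ℓ} ∧ ∃ y, (v', some ℓ, y) ∈
      (fun w => (w, lab G w, (fun v => v) '' G.neighborSet w)) '' ball G Set.univ L v ∧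
        w' ∈ y := by
    rw [inside]
    congr 1
    ext a c
    refine and_congr_right fun ha => and_congr_right fun hc => ?_
    constructor
    · intro hac
      have ha' : lab G a = some ℓ := ha
      exact ⟨(fun v => v) '' G.neighborSet a, ⟨a, hball a ha, by simp only [ha']⟩, ⟨c, hac, rfl⟩⟩
    · rintro ⟨y, ⟨u, -, hu⟩, hy⟩
      simp only [Prod.mk.injEq] at hu
      obtain ⟨rfl, -, rfl⟩ := hu
      simpa using hy
  simp only [e1]
  rw [e2]

/-- The number of rounds that suffice to find the vertices of one color. -/
def colorTime (b : ℕ) : ℕ :=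
  b * phaseLength b * (2 * (b * phaseLength b) + 1) + 1 + 2 * (b * phaseLength b)

open Classical in
theorem isLocal_remaining (hid : Function.Injective ident) (j : ℕ) :
    IsLocal ident (j * colorTime b) fun G v => v ∈ remaining G bit b j := by
  induction j with
  | zero => exact IsLocal.const _
  | succ j ih =>
    have h0 : IsLocal ident (j * colorTime b) fun G => initialLabel (remaining G bit b j) := by
      exact (((IsLocal.self hid).mono (Nat.zero_le _)).pair ih).comp
        fun x => if x.2 then some x.1 else none
    have h1 := isLocal_carved (b := b) hid (isLocal_clustering (bit := bit) (b := b) hid h0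
      (fun G => close_initialLabel _) b le_rfl)
      (fun G => (close_initialLabel _).clustering b) le_rfl
    have h2 := ((ih.mono (by rw [add_assoc, add_assoc]; exact Nat.le_add_right _ _)).pair
      h1).comp fun x => x.1 ∧ ¬ x.2
    exact h2.mono (by rw [Nat.add_mul, one_mul]; unfold colorTime; omega)

theorem isLocal_color (hid : Function.Injective ident) :
    IsLocal ident (3 * b * colorTime b) fun G v => color G bit b v := by
  refine (IsLocal.pi (φ := fun j G v => j < 3 * b ∧ v ∉ remaining G bit b (j + 1))
    fun j => ?_).comp fun p => sInf {j | p j}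
  by_cases hj : j < 3 * b
  · exact ((isLocal_remaining hid (j + 1)).mono (Nat.mul_le_mul_right _ hj)).comp
      -- The bound `j < 3 * b` inside `color` makes all later indices constant, so one round bound
      -- serves every `j`.
      fun p => j < 3 * b ∧ ¬ p
  · simp only [hj, false_and]
    exact IsLocal.const _

theorem mul_colorTime_le (b : ℕ) : 3 * b * colorTime b ≤ 135 * b ^ 8 := by
  rcases Nat.eq_zero_or_pos b with rfl | hb
  · simp
  have hS : b * phaseLength b ≤ 4 * b ^ 3 := by
    calc b * phaseLength b = 2 * b ^ 2 * (b + 1) := by rw [phaseLength]; ring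
      _ ≤ 2 * b ^ 2 * (b + b) := by gcongr; omega
      _ = 4 * b ^ 3 := by ring
  have h3 : b ^ 3 ≤ b ^ 6 := Nat.pow_le_pow_right hb (by norm_num)
  have h0 : 1 ≤ b ^ 6 := Nat.one_le_pow _ _ hb
  calc 3 * b * colorTime b
      ≤ 3 * b * (4 * b ^ 3 * (2 * (4 * b ^ 3) + 1) + 1 + 2 * (4 * b ^ 3)) := by
        rw [colorTime]; gcongr
    _ = 3 * b * (32 * b ^ 6 + 12 * b ^ 3 + 1) := by ring
    -- Here `45 = 32 + 12 + 1`.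
    _ ≤ 3 * b * (45 * b ^ 6) := by gcongr; omega
    _ = 135 * b ^ 7 := by ring
    _ ≤ 135 * b ^ 8 := by gcongr; norm_num

end Locality

/-! ### Running a view function as a LOCAL algorithm -/

section Simulation

variable {Param Out : Type}

open Classical in
/-- The algorithm in which every node collects its view for `T p` rounds and then applies `F p`. -/
noncomputable def viewAlgorithm (T : Param → ℕ) (F : (p : Param) → View (T p) → Out) :
    LocalAlgorithm Param Out where
  State := Param × (Σ t, View t)
  Msg := Σ t, View t
  init p i _ := (p, ⟨0, i⟩)
  send s _ := s.2
  receive s M :=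
    if s.2.1 < T s.1 then (s.1, ⟨s.2.1 + 1, (s.2.2, {y | ∃ j, (j, ⟨s.2.1, y⟩) ∈ M})⟩) else s
  output s := if h : s.2.1 = T s.1 then some (F s.1 (h ▸ s.2.2)) else none

variable {V W : Type*} [Fintype W] {T : Param → ℕ} {F : (p : Param) → View (T p) → Out}
  {G : SimpleGraph W} {ident : W → ℕ} {p : Param} {e : W ↪ V} {ident' : V → ℕ}

/-- Describing the messages by membership lets neighbor states be rewritten in a proposition instead
of inside a `Finset.image`. -/
theorem LocalAlgorithm.exists_stateAt_succ (A : LocalAlgorithm Param Out) (t : ℕ) (v : W) :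
    ∃ M : Finset (ℕ × A.Msg),
      (∀ x, x ∈ M ↔ ∃ w, G.Adj v w ∧ (ident w, A.send (A.stateAt G ident p t w) (ident v)) = x) ∧
      A.stateAt G ident p (t + 1) v = A.receive (A.stateAt G ident p t v) M :=
  ⟨_, by simp, rfl⟩

/-- All nodes are at the same stage, so matching the stage in `receive` loses no message; and `e v`
has only images of neighbors of `v` as neighbors. -/
theorem stateAt_viewAlgorithm_of_le (he : ∀ w, ident' (e w) = ident w) {t : ℕ} (ht : t ≤ T p)
    (v : W) : (viewAlgorithm T F).stateAt G ident p t v =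
      (p, ⟨t, view ident' (G.map e) t (e v)⟩) := by
  induction t generalizing v with
  | zero => simp [LocalAlgorithm.stateAt, viewAlgorithm, view, he]
  | succ t ih =>
    have ih := ih (by omega)
    obtain ⟨M, hM, hst⟩ := (viewAlgorithm T F).exists_stateAt_succ (G := G) (ident := ident)
      (p := p) t v
    simp only [ih] at hM hst
    refine hst.trans ((if_pos (by omega : t < T p)).trans ?_)
    refine congrArg (fun x => (p, (⟨t + 1, (view ident' (G.map e) t (e v), x)⟩ : Σ t, View t))) ?_
    ext y
    constructor
    · rintro ⟨j, h⟩
      obtain ⟨w, hw, h⟩ := (hM _).1 h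
      exact ⟨e w, (SimpleGraph.map_adj _ _ _ _).2 ⟨v, w, hw, rfl, rfl⟩,
        eq_of_heq (Sigma.mk.inj (Prod.mk.inj h).2).2⟩
    · rintro ⟨x, hx, rfl⟩
      obtain ⟨v', w, hw, hv', rfl⟩ := (SimpleGraph.map_adj _ _ _ _).1 hx
      obtain rfl := e.injective hv'
      exact ⟨ident w, (hM _).2 ⟨w, hw, rfl⟩⟩

theorem stateAt_viewAlgorithm_of_ge (he : ∀ w, ident' (e w) = ident w) {t : ℕ} (ht : T p ≤ t)
    (v : W) : (viewAlgorithm T F).stateAt G ident p t v =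
      (p, ⟨T p, view ident' (G.map e) (T p) (e v)⟩) := by
  induction ht generalizing v with
  | refl => exact stateAt_viewAlgorithm_of_le he le_rfl v
  | step _ ih =>
    rw [LocalAlgorithm.stateAt, ih]
    exact if_neg (lt_irrefl _)

theorem outputsWithin_viewAlgorithm (he : ∀ w, ident' (e w) = ident w) :
    (viewAlgorithm T F).OutputsWithin G ident p (T p)
      fun v => F p (view ident' (G.map e) (T p) (e v)) := by
  refine fun v => ⟨T p, le_rfl, fun s hs => ?_, fun s hs => ?_⟩
  · rw [stateAt_viewAlgorithm_of_le he hs.le]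
    exact dif_neg hs.ne
  · rw [stateAt_viewAlgorithm_of_ge he hs]
    exact dif_pos rfl

end Simulation

/-! ### Pulling the result back along the embedding -/

section Transport

variable {V W : Type*} {G : SimpleGraph W} {e : W ↪ V}

theorem exists_mem_ball_of_mem_ball_map {U : Set V} {r : ℕ} {v : W} {c : V}
    (h : c ∈ ball (G.map e) U r (e v)) : ∃ c', e c' = c ∧ c' ∈ ball G (e ⁻¹' U) r v := by
  induction r generalizing v with
  | zero => obtain ⟨rfl, h⟩ := h; exact ⟨v, rfl, rfl, h⟩
  | succ r ih =>
    obtain ⟨h0, h | ⟨x, hx, h⟩⟩ := h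
    · obtain ⟨c', hc, h⟩ := ih h
      exact ⟨c', hc, h0, Or.inl h⟩
    · obtain ⟨v', w, hvw, hv', rfl⟩ := (SimpleGraph.map_adj _ _ _ _).1 hx
      obtain rfl := e.injective hv'
      obtain ⟨c', hc, h⟩ := ih h
      exact ⟨c', hc, h0, Or.inr ⟨w, hvw, h⟩⟩

/-- A center is reached from an image vertex, hence is an image vertex itself, and `Function.invFun`
recovers it. -/
theorem IsCentering.of_map [Nonempty W] {U : Set V} {r : ℕ} {cent : V → V}
    (h : IsCentering (G.map e) U r cent) :
    IsCentering G (e ⁻¹' U) r fun v => Function.invFun e (cent (e v)) where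
  mem_ball v hv := by
    obtain ⟨c, hc, hvc⟩ := exists_mem_ball_of_mem_ball_map (mem_ball_symm (h.mem_ball _ hv))
    rw [← hc, Function.leftInverse_invFun e.injective]
    exact mem_ball_symm hvc
  eq_of_adj v hv w hw hvw := by
    rw [h.eq_of_adj _ hv _ hw ((SimpleGraph.map_adj_apply).2 hvw)]

end Transport

/-- The bits of an identifier. -/
def idBit {b : ℕ} (x : Fin (2 ^ b)) (j : ℕ) : Bool := x.val.testBit j

theorem eq_of_idBit_eq {b : ℕ} (x y : Fin (2 ^ b)) (h : ∀ j < b, idBit x j = idBit y j) :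
    x = y := by
  refine Fin.ext (Nat.eq_of_testBit_eq fun j => ?_)
  by_cases hj : j < b
  · exact h j hj
  · have hp : 2 ^ b ≤ 2 ^ j := Nat.pow_le_pow_right (by norm_num) (by omega)
    rw [Nat.testBit_lt_two_pow (x.2.trans_le hp), Nat.testBit_lt_two_pow (y.2.trans_le hp)]

/-- With all `b`-bit strings as vertices, the decoder depends on `b` alone, so the algorithm is
fixed before the network. -/
theorem isLocal_color_fin (b : ℕ) :
    IsLocal (Fin.val (n := 2 ^ b)) (135 * b ^ 8) fun G v => color G idBit b v :=
  (isLocal_color Fin.val_injective).mono (mul_colorTime_le b)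

/-- Every node collects its view and computes its color from it. -/
noncomputable def decompositionAlgorithm : LocalAlgorithm GlobalInfo ℕ :=
  viewAlgorithm (fun p => 135 * p.idBits ^ 8) fun p => (isLocal_color_fin p.idBits).choose

theorem decompositionAlgorithm_spec {W : Type*} [Fintype W] [Nonempty W] (G : SimpleGraph W)
    (ident : W → ℕ) (hid : Function.Injective ident) (p : GlobalInfo) (hb : 0 < p.idBits)
    (hlt : ∀ v, ident v < 2 ^ p.idBits) :
    ∃ col : W → ℕ,
      decompositionAlgorithm.OutputsWithin G ident p (135 * p.idBits ^ 8) col ∧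
      IsStrongNetworkDecomposition G col (3 * p.idBits) (2 * p.idBits) := by
  let e : W ↪ Fin (2 ^ p.idBits) :=
    ⟨fun v => ⟨ident v, hlt v⟩, fun v w h => hid (Fin.mk.inj_iff.1 h)⟩
  have hV : Nat.card (Fin (2 ^ p.idBits)) ≤ 2 ^ p.idBits := by simp
  refine ⟨fun v => color (G.map e) idBit p.idBits (e v), ?_,
    fun v => (color_spec hb hV (e v)).1, fun i hi K => ?_⟩
  · have h := outputsWithin_viewAlgorithm (T := fun p : GlobalInfo => 135 * p.idBits ^ 8)
      (F := fun p => (isLocal_color_fin p.idBits).choose) (G := G) (ident := ident) (p := p)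
      (e := e) (ident' := Fin.val) fun _ => rfl
    simp only [← (isLocal_color_fin p.idBits).choose_spec] at h
    exact h
  · obtain ⟨cent, hc⟩ := exists_isCentering_color (G := G.map e) hb hV eq_of_idBit_eq hi
    exact hc.of_map.ediam_le K

end LocalModel

theorem theorem1p2 :
    ∃ A : LocalModel.LocalAlgorithm LocalModel.GlobalInfo ℕ,
      ∀ c : ℕ, ∃ C : ℝ,
        ∀ (V : Type*) [Fintype V] (G : SimpleGraph V) (n N b : ℕ) (ident : V → ℕ),
          Fintype.card V = n → 2 ≤ n →
          n ≤ N → N ≤ n ^ c →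
          (b : ℝ) ≤ c * Real.log n →
          Function.Injective ident → (∀ v, ident v < 2 ^ b) →
          ∃ (T k d : ℕ) (col : V → ℕ),
            (T : ℝ) ≤ C * Real.log n ^ 8 ∧
            (k : ℝ) ≤ C * Real.log n ∧
            (d : ℝ) ≤ C * Real.log n ∧
            A.OutputsWithin G ident ⟨N, b⟩ T col ∧
            LocalModel.IsStrongNetworkDecomposition G col k d := by
  -- The first summand pays for the rounds, the second for the `3 * b` colors and the diameter `2 *
  -- b`.
  refine ⟨LocalModel.decompositionAlgorithm, fun c => ⟨135 * c ^ 8 + 3 * c, ?_⟩⟩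
  intro V _ G n N b ident hn hn2 _ _ hbc hid hlt
  have hV : 1 < Fintype.card V := by omega
  have : Nonempty V := Fintype.card_pos_iff.1 (by omega)
  -- With `b = 0` two distinct nodes would share the identifier `0`.
  have hb : 0 < b := by
    obtain ⟨v, w, hvw⟩ := Fintype.one_lt_card_iff.1 hV
    rcases Nat.eq_zero_or_pos b with rfl | hb
    · have hv := hlt v
      have hw := hlt w
      exact absurd (hid (by omega)) hvw
    · exact hb
  obtain ⟨col, h1, h2⟩ :=
    LocalModel.decompositionAlgorithm_spec G ident hid ⟨N, b⟩ hb hlt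
  have hlog : 0 ≤ Real.log n := Real.log_natCast_nonneg n
  have hc : (0 : ℝ) ≤ c := Nat.cast_nonneg c
  have hc8 : (0 : ℝ) ≤ 135 * c ^ 8 := by positivity
  refine ⟨_, _, _, col, ?_, ?_, ?_, h1, h2⟩
  · calc ((135 * b ^ 8 : ℕ) : ℝ) = 135 * (b : ℝ) ^ 8 := by push_cast; ring
      _ ≤ 135 * (c * Real.log n) ^ 8 := by gcongr
      _ = 135 * c ^ 8 * Real.log n ^ 8 := by ring
      _ ≤ (135 * c ^ 8 + 3 * c) * Real.log n ^ 8 := by gcongr; linarith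
  · calc ((3 * b : ℕ) : ℝ) = 3 * (b : ℝ) := by push_cast; ring
      _ ≤ 3 * (c * Real.log n) := by gcongr
      _ = 3 * c * Real.log n := by ring
      _ ≤ (135 * c ^ 8 + 3 * c) * Real.log n := by gcongr; linarith
  · calc ((2 * b : ℕ) : ℝ) = 2 * (b : ℝ) := by push_cast; ring
      _ ≤ 2 * (c * Real.log n) := by gcongr
      _ = 2 * c * Real.log n := by ring
      _ ≤ (135 * c ^ 8 + 3 * c) * Real.log n := by gcongr; linarith
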